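/- Definitions. Let $w=w_1\cdots w_n\in\{0,1\}^n$; an index $i\in\{1,\dots,n\}$ is called honest if $w_i=0$ and adversarial if $w_i=1$. A *fork* $F\vdash w$ is a finite rooted tree, with edges directed away from the root, and a labeling $\ell:V\to\{0,1,\dots,n\}$ of its vertices such that: the root has label $0$; labels strictly increase along directed paths; every honest index is the label of exactly one vertex; and if $i<j$ are honest indices, then the depth of the vertex labeled $i$ is strictly less than the depth of the vertex labeled $j$. A fork is *closed* if every leaf is labeled with an honest index; the trivial fork (the root alone) is also closed. A *tine* $t$ of $F$ is a directed path starting at the root (not necessarily ending at a leaf); $\mathrm{length}(t)$ is its number of edges and $\ell(t)$ is the label of its last vertex. For a closed fork $F\vdash w$, let $\mathrm{gap}(t)$ be the length of a longest tine of $F$ minus $\mathrm{length}(t)$, let $\mathrm{reserve}(t)=|\{i : w_i=1,\ i>\ell(t)\}|$, and let $\mathrm{reach}(t)=\mathrm{reserve}(t)-\mathrm{gap}(t)$. If $w=xy$, write $t_1\nsim_x t_2$ when the tines $t_1,t_2$ (possibly equal) share no edge that terminates at a vertex labeled with an index belonging to $y$, i.e. with a label larger than $|x|$. The *relative margin* is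 $$\mu_x(y)=\max_{F\vdash xy,\ F\text{ closed}}\ \ \max_{t_1\nsim_x t_2}\ \min\{\mathrm{reach}(t_1),\mathrm{reach}(t_2)\},$$ where the inner maximum is over pairs of tines of $F$. For $\epsilon\in(0,1)$, let $\mathcal B_\epsilon$ denote the distribution on $\{0,1\}^n$ under which the bits are independent and each equals $1$ with probability $(1-\epsilon)/2$. Theorem. There is an absolute constant $C$ such that for all $\epsilon\in(0,1)$ and all integers $m,k\ge 0$: if $x\in\{0,1\}^m$ and $y\in\{0,1\}^k$ are independent random variables, each distributed according to $\mathcal B_\epsilon$, then $$\Pr[\mu_x(y)\ge 0]\ \le\ \exp\!\bigl(-\epsilon^3(1-C\epsilon)\,k/2\bigr).$$ (That is, $\Pr[\mu_x(y)\ge 0]\le\exp(-\epsilon^3(1-O(\epsilon))k/2)$ with an implied constant that does not depend on $\epsilon$, $m$ or $k$.) -/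

import Mathlib

open MeasureTheory ProbabilityTheory

namespace ForkMargin

/-! ### Characteristic strings

A characteristic string is a list of Booleans: `false` is the symbol `0` (a slot with a unique
honest leader) and `true` is the symbol `1` (an adversarial slot). Slots are numbered from `1`. -/

/-- `symbolAt w i` is the symbol `w_i` of slot `i`, if `1 ≤ i ≤ |w|`. -/
def symbolAt (w : List Bool) : ℕ → Option Bool
  | 0 => none
  | i + 1 => w[i]?

/-- `i` is an honest index of `w`: `1 ≤ i ≤ |w|` and `w_i = 0`. -/
def IsHonest (w : List Bool) (i : ℕ) : Prop := symbolAt w i = some false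

/-- `i` is an adversarial index of `w`: `1 ≤ i ≤ |w|` and `w_i = 1`. -/
def IsAdversarial (w : List Bool) (i : ℕ) : Prop := symbolAt w i = some true

instance (w : List Bool) : DecidablePred (IsHonest w) :=
  fun i => inferInstanceAs (Decidable (symbolAt w i = some false))

instance (w : List Bool) : DecidablePred (IsAdversarial w) :=
  fun i => inferInstanceAs (Decidable (symbolAt w i = some true))

/-! ### Rooted trees and forks -/

/-- A finite rooted tree, all edges being directed away from the root. It is given by its parent
map: the edges are `parent v → v` for the vertices `v ≠ root`. The value of `parent` at the root
is a mere convention and does not represent an edge. -/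
structure FinRootedTree where
  V : Type
  [fintypeV : Fintype V]
  root : V
  parent : V → V
  parent_root : parent root = root
  reaches_root : ∀ v, ∃ n, parent^[n] v = root

attribute [instance] FinRootedTree.fintypeV

namespace FinRootedTree

variable (T : FinRootedTree)

open Classical in
/-- The depth of `v`: the number of edges of the path from the root to `v`. -/
noncomputable def depth (v : T.V) : ℕ := Nat.find (T.reaches_root v)

/-- The height of the tree: the length of a longest path starting at the root. -/
noncomputable def height : ℕ := Finset.univ.sup T.depth

/-- `T.OnPath u v`: the vertex `u` lies on the path from the root to `v`. -/
def OnPath (u v : T.V) : Prop := ∃ n, T.parent^[n] v = u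

/-- A leaf is a vertex without children. -/
def IsLeaf (v : T.V) : Prop := ∀ u, u ≠ T.root → T.parent u ≠ v

end FinRootedTree

/-- A fork `F ⊢ w` for the characteristic string `w`. -/
structure Fork (w : List Bool) extends FinRootedTree where
  /-- The labelling of the vertices by `0, 1, …, |w|`. -/
  label : V → ℕ
  label_le : ∀ v, label v ≤ w.length
  /-- The root has label `0`. -/
  label_root : label root = 0
  /-- Labels strictly increase along every edge, hence along every directed path. -/
  label_lt : ∀ v, v ≠ root → label (parent v) < label v
  /-- Every honest index is the label of exactly one vertex. -/
  honest_unique : ∀ i, IsHonest w i → ∃! v, label v = i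
  /-- Depths of honest vertices strictly increase with their labels. -/
  honest_depth : ∀ u v, IsHonest w (label u) → IsHonest w (label v) → label u < label v →
    toFinRootedTree.depth u < toFinRootedTree.depth v

namespace Fork

variable {w : List Bool} (F : Fork w)

/-! A *tine* of `F` is a directed path that starts at the root (it need not end at a leaf). It is
determined by its terminal vertex, and is represented by that vertex: its length is the depth of
that vertex, its edges are the edges `parent u → u` for the vertices `u ≠ root` on it. -/

/-- A fork is closed if every leaf is honest; by convention the trivial fork, consisting of the
root alone, is closed too. (The root is a leaf of the trivial fork only.) -/
def Closed : Prop := ∀ v, F.IsLeaf v → v ≠ F.root → IsHonest w (F.label v)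

/-- The gap of a tine: length of the longest tine minus length of the tine. -/
noncomputable def gap (t : F.V) : ℤ := (F.height : ℤ) - F.depth t

/-- The reserve of a tine: the number of adversarial indices after its terminal vertex. -/
def reserve (t : F.V) : ℕ :=
  ((Finset.Icc 1 w.length).filter fun i => IsAdversarial w i ∧ F.label t < i).card

/-- The reach of a tine. -/
noncomputable def reach (t : F.V) : ℤ := (F.reserve t : ℤ) - F.gap t

/-- `F.DisjointOver x t₁ t₂`, for a fork `F ⊢ x ++ y`: the tines `t₁` and `t₂` share no edge that
terminates at a vertex labelled with an index of `y`, i.e. with a label larger than `|x|`. -/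
def DisjointOver (x : List Bool) (t₁ t₂ : F.V) : Prop :=
  ¬ ∃ u, u ≠ F.root ∧ F.OnPath u t₁ ∧ F.OnPath u t₂ ∧ x.length < F.label u

/-- The values `min {reach t₁, reach t₂}` over all pairs of tines that are disjoint over `y`
(a tine may be paired with itself, if it is disjoint from itself over `y`). -/
def marginValues (x : List Bool) : Set ℤ :=
  {r | ∃ t₁ t₂, F.DisjointOver x t₁ t₂ ∧ r = min (F.reach t₁) (F.reach t₂)}

/-- The relative margin `μ_x(F)` of a fork `F ⊢ x ++ y`: the maximum of
`min {reach t₁, reach t₂}` over all pairs of tines that are disjoint over `y`. -/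
noncomputable def relMargin (x : List Bool) : ℤ := sSup (F.marginValues x)

end Fork

/-- The relative margins of all closed forks for `x ++ y`. -/
def relMarginValues (x y : List Bool) : Set ℤ :=
  {r | ∃ F : Fork (x ++ y), F.Closed ∧ r = F.relMargin x}

/-- The relative margin `μ_x(y)`: the maximum of `μ_x(F)` over all closed forks `F ⊢ x ++ y`. -/
noncomputable def relMargin (x y : List Bool) : ℤ := sSup (relMarginValues x y)

/-! ### The two maxima exist -/

namespace Fork

variable {w : List Bool} (F : Fork w)

theorem reach_le (t : F.V) : F.reach t ≤ w.length := by
  have h1 : F.reserve t ≤ w.length := by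
    unfold reserve
    exact (Finset.card_filter_le _ _).trans (by simp)
  have h2 : F.depth t ≤ F.height := Finset.le_sup (f := F.depth) (Finset.mem_univ t)
  unfold reach gap
  omega

theorem marginValues_nonempty (x : List Bool) : (F.marginValues x).Nonempty := by
  refine ⟨_, F.root, F.root, ?_, rfl⟩
  rintro ⟨u, hu, ⟨n, hn⟩, -, -⟩
  exact hu (hn ▸ Function.iterate_fixed F.parent_root n)

theorem marginValues_le (x : List Bool) {r : ℤ} (hr : r ∈ F.marginValues x) : r ≤ w.length := by
  obtain ⟨t₁, t₂, -, rfl⟩ := hr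
  exact (min_le_left _ _).trans (F.reach_le t₁)

/-- `μ_x(F)` is a maximum. -/
theorem relMargin_isGreatest (x : List Bool) : IsGreatest (F.marginValues x) (F.relMargin x) :=
  have hb : BddAbove (F.marginValues x) := ⟨_, fun _ hr => F.marginValues_le x hr⟩
  ⟨Int.csSup_mem (F.marginValues_nonempty x) hb, fun _ hr => le_csSup hb hr⟩

end Fork

section Existence

/-- The largest honest index below `i`, or `0` if there is none. -/
def prevHonest (w : List Bool) (i : ℕ) : ℕ :=
  Nat.findGreatest (fun j => j < i ∧ IsHonest w j) i

theorem prevHonest_prop (w : List Bool) (i : ℕ) :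
    prevHonest w i = 0 ∨ (prevHonest w i < i ∧ IsHonest w (prevHonest w i)) := by
  by_cases h : prevHonest w i = 0
  · exact Or.inl h
  · right
    exact Nat.findGreatest_of_ne_zero (P := fun j => j < i ∧ IsHonest w j) rfl h

theorem le_prevHonest {w : List Bool} {i j : ℕ} (hj : IsHonest w j) (hji : j < i) :
    j ≤ prevHonest w i := by
  exact Nat.le_findGreatest hji.le ⟨hji, hj⟩

theorem IsHonest.le_length {w : List Bool} {i : ℕ} (h : IsHonest w i) : i ≤ w.length := by
  cases i with
  | zero => simp
  | succ i =>
    have : w[i]? = some false := h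
    obtain ⟨h', -⟩ := List.getElem?_eq_some_iff.1 this
    exact h'

theorem prevHonest_lt {w : List Bool} {i : ℕ} (hi : i ≠ 0) : prevHonest w i < i := by
  rcases prevHonest_prop w i with h | h
  · omega
  · exact h.1

theorem prevHonest_zero (w : List Bool) : prevHonest w 0 = 0 := Nat.findGreatest_zero

/-- The vertices of the path that carries one vertex for each honest index. -/
abbrev HonestPathV (w : List Bool) : Type := {i : Fin (w.length + 1) // i.1 = 0 ∨ IsHonest w i.1}

/-- The parent map of the honest path. -/
def honestParent (w : List Bool) (v : HonestPathV w) : HonestPathV w :=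
  ⟨⟨prevHonest w v.1.1, by
      rcases prevHonest_prop w v.1.1 with h | h
      · omega
      · have := h.1; have := v.1.2; omega⟩,
    (prevHonest_prop w v.1.1).imp id And.right⟩

theorem honestParent_reaches (w : List Bool) (n : ℕ) (v : HonestPathV w) (hv : v.1.1 ≤ n) :
    ((honestParent w)^[n] v).1.1 = 0 := by
  induction n generalizing v with
  | zero => simpa using hv
  | succ n ih =>
    rw [Function.iterate_succ_apply]
    apply ih
    change prevHonest w v.1.1 ≤ n
    by_cases h : v.1.1 = 0
    · rw [h]
      exact (prevHonest_zero w).le.trans (Nat.zero_le n)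
    · have := prevHonest_lt (w := w) h
      omega

/-- The path that carries one vertex for each honest index. -/
def honestPath (w : List Bool) : FinRootedTree where
  V := HonestPathV w
  root := ⟨0, Or.inl rfl⟩
  parent := honestParent w
  parent_root := Subtype.ext (Fin.ext (prevHonest_zero w))
  reaches_root v := ⟨v.1.1, Subtype.ext (Fin.ext (honestParent_reaches w _ v le_rfl))⟩

theorem FinRootedTree.depth_eq (T : FinRootedTree) {v : T.V} (hv : v ≠ T.root) :
    T.depth v = T.depth (T.parent v) + 1 := by
  classical
  unfold FinRootedTree.depth
  rw [Nat.find_comp_succ (T.reaches_root v) (T.reaches_root (T.parent v)) (by simpa using hv)]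
  simp only [Function.iterate_succ_apply]

theorem honestPath_depth_lt (w : List Bool) (n : ℕ) (u v : (honestPath w).V) (hv : v.1.1 ≤ n)
    (huv : u.1.1 < v.1.1) : (honestPath w).depth u < (honestPath w).depth v := by
  induction n generalizing v with
  | zero => omega
  | succ n ih =>
    have hv0 : v ≠ (honestPath w).root := by
      rintro rfl
      exact absurd huv (Nat.not_lt_zero _)
    have hle : u.1.1 ≤ (honestParent w v).1.1 := by
      rcases u.2 with h | h
      · omega
      · exact le_prevHonest h huv
    have hlt : (honestParent w v).1.1 < v.1.1 := prevHonest_lt (by omega)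
    rw [FinRootedTree.depth_eq _ hv0]
    rcases hle.lt_or_eq with h | h
    · have := ih (honestParent w v) (by omega) h
      exact Nat.lt_succ_of_lt this
    · have : u = (honestPath w).parent v := Subtype.ext (Fin.ext h)
      rw [← this]
      exact Nat.lt_succ_self _

/-- The fork that is a path with one vertex for each honest index. -/
def honestFork (w : List Bool) : Fork w where
  toFinRootedTree := honestPath w
  label v := v.1.1
  label_le v := Nat.lt_succ_iff.1 v.1.2
  label_root := rfl
  label_lt _ hv := prevHonest_lt fun h => hv (Subtype.ext (Fin.ext h))
  honest_unique i hi :=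
    ⟨⟨⟨i, Nat.lt_succ_iff.2 hi.le_length⟩, Or.inr hi⟩, rfl, fun _ h => Subtype.ext (Fin.ext h)⟩
  honest_depth u v _ _ h := honestPath_depth_lt w _ u v le_rfl h

theorem honestFork_closed (w : List Bool) : (honestFork w).Closed := fun v _ hv =>
  v.2.resolve_left fun h => hv (Subtype.ext (Fin.ext h))

end Existence

/-- `μ_x(y)` is a maximum. -/
theorem relMargin_isGreatest (x y : List Bool) :
    IsGreatest (relMarginValues x y) (relMargin x y) := by
  have hb : BddAbove (relMarginValues x y) := by
    refine ⟨((x ++ y).length : ℤ), ?_⟩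
    rintro _ ⟨F, -, rfl⟩
    exact F.marginValues_le x (F.relMargin_isGreatest x).1
  have hn : (relMarginValues x y).Nonempty := ⟨_, honestFork (x ++ y), honestFork_closed _, rfl⟩
  exact ⟨Int.csSup_mem hn hb, fun _ hr => le_csSup hb hr⟩

/-! ### The distribution of the strings -/

/-- The distribution `𝓑_ε` on `{0,1}^n`: independent bits, each equal to `1` (`true`) with
probability `(1 - ε) / 2` and to `0` (`false`) with the complementary probability. -/
noncomputable def bitsLaw (ε : ℝ) (hε : ε ∈ Set.Ioo (0 : ℝ) 1) (n : ℕ) :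
    Measure (Fin n → Bool) :=
  Measure.pi fun _ => bernoulliMeasure true false
    (⟨(1 - ε) / 2, by linarith [hε.2], by linarith [hε.1]⟩ : unitInterval)

end ForkMargin

namespace ForkMargin

/-! ### The recursion that bounds the margin -/

/-! Two steps carry the proof: a deterministic bound on the margin, then a supermartingale for the
resulting walk.

Deterministic step. Measured slot by slot against the deepest honest vertex so far, the largest
reach and the best minimum over disjoint pairs are bounded by the walk `marginRec`
(`Fork.reachAt_le_reachRec`, `Fork.min_reachAt_le_marginRec`). An adversarial slot raises reaches by
at most one; an honest slot lowers every old reach by at least one and creates a single tine of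
reach 0. That new tine explains why the margin may stay at 0 as long as the reach is positive. Only
an upper bound is needed, so no optimal fork is constructed.

Probabilistic step. With `a` slightly above 1, `potential a (1 - ε)` shrinks in mean by a factor `c
= 1 - 3/4 * ε ^ 3` per symbol (`potential_step`) and is at least 1 when the margin is nonnegative.
The probability is thus at most `c ^ k` times the mean of `a ^ reachRec x`, and that mean is at most
`1 + ε / 2` uniformly in `m`, because the reach has geometric tails. The prefactor is absorbed by
the spare decay when `ε ^ 2 * k > 2`; for smaller `k` the last symbol alone suffices
(`marginProb_succ_le`). -/

/-- The effect of one symbol on the maximal reach. -/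
def reachStep (r : ℕ) (b : Bool) : ℕ := if b then r + 1 else r - 1

/-- The effect of one symbol on the pair (maximal reach, relative margin). -/
def marginStep (s : ℕ × ℤ) (b : Bool) : ℕ × ℤ :=
  (reachStep s.1 b, if b then s.2 + 1 else if s.2 = 0 ∧ 0 < s.1 then 0 else s.2 - 1)

/-- The maximal reach, as computed by the recursion. -/
def reachRec (w : List Bool) : ℕ := w.foldl reachStep 0

/-- The pair (maximal reach, relative margin), as computed by the recursion. -/
def marginRec (x y : List Bool) : ℕ × ℤ := y.foldl marginStep (reachRec x, reachRec x)

theorem reachRec_concat (w : List Bool) (b : Bool) :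
    reachRec (w ++ [b]) = reachStep (reachRec w) b := by
  simp [reachRec]

theorem marginRec_concat (x y : List Bool) (b : Bool) :
    marginRec x (y ++ [b]) = marginStep (marginRec x y) b := by
  simp [marginRec]

theorem foldl_marginStep_fst (y : List Bool) (s : ℕ × ℤ) :
    (y.foldl marginStep s).1 = y.foldl reachStep s.1 := by
  induction y generalizing s with
  | nil => rfl
  | cons b y ih => simp [ih, marginStep]

theorem marginRec_fst (x y : List Bool) : (marginRec x y).1 = reachRec (x ++ y) := by
  simp [marginRec, reachRec, foldl_marginStep_fst]

theorem marginStep_snd_le {s : ℕ × ℤ} (hs : s.2 ≤ s.1) (b : Bool) :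
    (marginStep s b).2 ≤ (marginStep s b).1 := by
  cases b
  · simp only [marginStep, reachStep, Bool.false_eq_true, if_false]
    split_ifs <;> omega
  · simp only [marginStep, reachStep, if_true]
    omega

theorem marginRec_snd_le (x y : List Bool) : (marginRec x y).2 ≤ (marginRec x y).1 := by
  induction y using List.reverseRecOn with
  | nil => exact le_rfl
  | append_singleton y b ih =>
    rw [marginRec_concat]
    exact marginStep_snd_le ih b

theorem symbolAt_concat_length (w : List Bool) (b : Bool) (u : List Bool) :
    symbolAt (w ++ b :: u) (w.length + 1) = some b := by
  simp [symbolAt]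

/-! ### Truncated reach -/

namespace FinRootedTree

variable (T : FinRootedTree)

theorem depth_root : T.depth T.root = 0 := by
  classical
  exact (Nat.find_eq_zero _).2 rfl

theorem onPath_refl (v : T.V) : T.OnPath v v := ⟨0, rfl⟩

variable {T}

theorem OnPath.of_parent {u v : T.V} (h : T.OnPath u (T.parent v)) : T.OnPath u v := by
  obtain ⟨n, hn⟩ := h
  exact ⟨n + 1, hn⟩

end FinRootedTree

namespace Fork

variable {w : List Bool} (F : Fork w)

/-- The largest depth of an honest vertex with label at most `n`. -/
noncomputable def honestHeight (n : ℕ) : ℕ :=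
  (Finset.univ.filter fun z => IsHonest w (F.label z) ∧ F.label z ≤ n).sup F.depth

/-- The reserve of a tine at time `n`: adversarial indices in `(ℓ(t), n]`. -/
def reserveAt (n : ℕ) (t : F.V) : ℕ :=
  ((Finset.Icc 1 n).filter fun i => IsAdversarial w i ∧ F.label t < i).card

/-- The reach of a tine at time `n`, relative to the honest vertices seen so far. -/
noncomputable def reachAt (n : ℕ) (t : F.V) : ℤ :=
  F.reserveAt n t - F.honestHeight n + F.depth t

/-- Measuring the gap only against honest vertices can only increase the reach. The induction over
slots can then run inside one fixed fork, without truncating it. -/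
theorem reach_le_reachAt (t : F.V) : F.reach t ≤ F.reachAt w.length t := by
  have h : F.honestHeight w.length ≤ F.height := Finset.sup_mono (Finset.subset_univ _)
  have h2 : F.reserve t = F.reserveAt w.length t := rfl
  unfold reach gap reachAt
  omega

theorem label_parent_lt {n : ℕ} {t : F.V} (ht : F.label t = n + 1) :
    t ≠ F.root ∧ F.label (F.parent t) ≤ n := by
  have h0 : t ≠ F.root := by
    rintro rfl
    have := F.label_root
    omega
  exact ⟨h0, by have := F.label_lt t h0; omega⟩

theorem DisjointOver.parent_left {F : Fork w} {x : List Bool} {t₁ t₂ : F.V}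
    (h : F.DisjointOver x t₁ t₂) :
    F.DisjointOver x (F.parent t₁) t₂ := by
  rintro ⟨u, hu, h1, h2, hl⟩
  exact h ⟨u, hu, h1.of_parent, h2, hl⟩

theorem DisjointOver.symm {F : Fork w} {x : List Bool} {t₁ t₂ : F.V}
    (h : F.DisjointOver x t₁ t₂) : F.DisjointOver x t₂ t₁ := by
  rintro ⟨u, hu, h1, h2, hl⟩
  exact h ⟨u, hu, h2, h1, hl⟩

theorem reserveAt_succ (n : ℕ) (t : F.V) :
    F.reserveAt (n + 1) t =
      F.reserveAt n t + if IsAdversarial w (n + 1) ∧ F.label t < n + 1 then 1 else 0 := by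
  unfold reserveAt
  rw [← Finset.insert_Icc_right_eq_Icc_add_one (by omega), Finset.filter_insert]
  split_ifs
  · rw [Finset.card_insert_of_notMem (by simp)]
  · simp

theorem reserveAt_eq_zero {n : ℕ} {t : F.V} (h : n ≤ F.label t) : F.reserveAt n t = 0 := by
  unfold reserveAt
  rw [Finset.card_eq_zero, Finset.filter_eq_empty_iff]
  intro i hi
  rw [Finset.mem_Icc] at hi
  omega

theorem reachAt_zero {t : F.V} (ht : F.label t ≤ 0) : F.reachAt 0 t ≤ 0 := by
  have h : t = F.root := by
    by_contra h
    have := F.label_lt t h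
    omega
  have h2 := F.reserveAt_eq_zero (t := t) (Nat.zero_le _)
  have h3 : F.depth t = 0 := h ▸ F.depth_root
  unfold reachAt
  omega

/-! ### Effect of an adversarial slot on the reach -/

section Adversarial

variable {n : ℕ} (hn : symbolAt w (n + 1) = some true)
include hn

theorem honestHeight_succ_of_adversarial : F.honestHeight (n + 1) = F.honestHeight n := by
  unfold honestHeight
  congr 1
  ext z
  simp only [Finset.mem_filter, Finset.mem_univ, true_and]
  refine and_congr_right fun hz => ⟨fun h => ?_, fun h => by omega⟩
  by_contra h'
  have : F.label z = n + 1 := by omega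
  rw [this, IsHonest, hn] at hz
  simp at hz

theorem reachAt_succ_of_adversarial {t : F.V} (ht : F.label t ≤ n) :
    F.reachAt (n + 1) t = F.reachAt n t + 1 := by
  have h := F.reserveAt_succ n t
  rw [if_pos ⟨hn, by omega⟩] at h
  have := F.honestHeight_succ_of_adversarial hn
  unfold reachAt
  omega

/-- The new vertex gains one unit of depth over its parent but has no reserve left, while the
parent's reserve is at least 0. -/
theorem reachAt_succ_le_parent {t : F.V} (ht : F.label t = n + 1) :
    F.reachAt (n + 1) t ≤ F.reachAt n (F.parent t) + 1 := by
  have h := F.reserveAt_eq_zero ht.ge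
  have := F.honestHeight_succ_of_adversarial hn
  have := FinRootedTree.depth_eq F.toFinRootedTree (F.label_parent_lt ht).1
  unfold reachAt
  omega

end Adversarial

/-! ### Effect of an honest slot on the reach -/

section Honest

variable {n : ℕ} (hn : symbolAt w (n + 1) = some false)
include hn

theorem honestHeight_succ_of_honest {v : F.V} (hv : F.label v = n + 1) :
    F.honestHeight (n + 1) = F.depth v ∧ F.honestHeight n < F.depth v := by
  have hhv : IsHonest w (F.label v) := hv ▸ hn
  have hlt : ∀ z, IsHonest w (F.label z) → F.label z ≤ n → F.depth z < F.depth v :=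
    fun z hz hzn => F.honest_depth z v hz hhv (by omega)
  have hpos : 0 < F.depth v := by
    rw [FinRootedTree.depth_eq F.toFinRootedTree (F.label_parent_lt hv).1]
    omega
  refine ⟨le_antisymm (Finset.sup_le fun z hz => ?_) (Finset.le_sup (f := F.depth) ?_), ?_⟩
  · rw [Finset.mem_filter] at hz
    by_cases h : F.label z ≤ n
    · exact (hlt z hz.2.1 h).le
    · have h1 : F.label z = n + 1 := by omega
      rw [(F.honest_unique (n + 1) hn).unique h1 hv]
  · exact Finset.mem_filter.2 ⟨Finset.mem_univ _, hhv, hv.le⟩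
  · refine (Finset.sup_lt_iff hpos).2 fun z hz => ?_
    rw [Finset.mem_filter] at hz
    exact hlt z hz.2.1 hz.2.2

/-- The new honest vertex is itself the deepest honest one and has no reserve. It lies strictly
below all earlier honest vertices in the tree, so its parent is already at least as deep as they
are. -/
theorem reachAt_of_honest {v : F.V} (hv : F.label v = n + 1) :
    F.reachAt (n + 1) v = 0 ∧ 0 ≤ F.reachAt n (F.parent v) := by
  obtain ⟨h1, h2⟩ := F.honestHeight_succ_of_honest hn hv
  have h := F.reserveAt_eq_zero hv.ge
  have := FinRootedTree.depth_eq F.toFinRootedTree (F.label_parent_lt hv).1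
  unfold reachAt
  omega

theorem reachAt_succ_of_honest (t : F.V) : F.reachAt (n + 1) t ≤ F.reachAt n t - 1 := by
  obtain ⟨v, hv, -⟩ := F.honest_unique (n + 1) hn
  obtain ⟨h1, h2⟩ := F.honestHeight_succ_of_honest hn hv
  have h := F.reserveAt_succ n t
  rw [if_neg (by simp [IsAdversarial, hn])] at h
  unfold reachAt
  omega

end Honest

/-! ### Reach and margin are dominated by the recursion -/

/-- The maximal reach is bounded by its recursion. -/
theorem reachAt_le_reachRec (l u : List Bool) (hw : w = l ++ u) (t : F.V)
    (ht : F.label t ≤ l.length) : F.reachAt l.length t ≤ reachRec l := by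
  induction l using List.reverseRecOn generalizing u t with
  | nil => exact (F.reachAt_zero ht).trans (by simp)
  | append_singleton l b ih =>
    have hs : symbolAt w (l.length + 1) = some b := by
      rw [hw, List.append_assoc]
      exact symbolAt_concat_length l b u
    have ih := ih ([b] ++ u) (by rw [hw, List.append_assoc])
    rw [List.length_append, List.length_singleton] at ht ⊢
    rw [reachRec_concat]
    rcases Nat.lt_or_ge l.length (F.label t) with h | h
    · have h : F.label t = l.length + 1 := by omega
      have ihp := ih _ (F.label_parent_lt h).2
      cases b
      · exact (F.reachAt_of_honest hs h).1.le.trans (by simp)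
      · have := F.reachAt_succ_le_parent hs h
        simp only [reachStep, if_true]
        omega
    · have iht := ih t h
      cases b
      · have := F.reachAt_succ_of_honest hs t
        simp only [reachStep, Bool.false_eq_true, if_false]
        omega
      · have := F.reachAt_succ_of_adversarial hs h
        simp only [reachStep, if_true]
        omega

/-- A tine ending at a fresh honest vertex, paired with an older one. -/
theorem min_reachAt_le_of_honest {n : ℕ} (hn : symbolAt w (n + 1) = some false) {x : List Bool}
    {s : ℕ × ℤ} (hs : s.2 ≤ s.1)
    (hR : ∀ t, F.label t ≤ n → F.reachAt n t ≤ s.1)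
    (hM : ∀ t₁ t₂, F.label t₁ ≤ n → F.label t₂ ≤ n → F.DisjointOver x t₁ t₂ →
      min (F.reachAt n t₁) (F.reachAt n t₂) ≤ s.2)
    {v t : F.V} (hv : F.label v = n + 1) (ht : F.label t ≤ n) (hd : F.DisjointOver x v t) :
    min (F.reachAt (n + 1) v) (F.reachAt (n + 1) t) ≤ (marginStep s false).2 := by
  obtain ⟨h0, hp⟩ := F.reachAt_of_honest hn hv
  have h1 := F.reachAt_succ_of_honest hn t
  have h2 := hM _ t (F.label_parent_lt hv).2 ht hd.parent_left
  have h3 := hR t ht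
  simp only [marginStep, Bool.false_eq_true, if_false]
  -- If the margin stays at 0, the reach 0 of `v` suffices. If `s.2 > 0`, that same 0 is at most
  -- `s.2 - 1`. If `s.2 < 0`, the parent of `v` has nonnegative reach, so `t` realises the minimum
  -- and loses one. If both entries are 0, `h3` bounds `t`.
  split_ifs <;> omega

/-- The relative margin is bounded by its recursion. -/
theorem min_reachAt_le_marginRec (x l u : List Bool) (hw : w = x ++ l ++ u) (t₁ t₂ : F.V)
    (h₁ : F.label t₁ ≤ (x ++ l).length) (h₂ : F.label t₂ ≤ (x ++ l).length)
    (hd : F.DisjointOver x t₁ t₂) :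
    min (F.reachAt (x ++ l).length t₁) (F.reachAt (x ++ l).length t₂) ≤ (marginRec x l).2 := by
  induction l using List.reverseRecOn generalizing u t₁ t₂ with
  | nil =>
    refine (min_le_left _ _).trans ?_
    rw [List.append_nil] at h₁ hw ⊢
    exact F.reachAt_le_reachRec x u hw t₁ h₁
  | append_singleton l b ih =>
    have hw' : w = x ++ l ++ ([b] ++ u) := by rw [hw]; simp
    have hs : symbolAt w ((x ++ l).length + 1) = some b := by
      rw [hw']
      exact symbolAt_concat_length _ b u
    have ih := ih _ hw'
    have hR : ∀ t, F.label t ≤ (x ++ l).length → F.reachAt (x ++ l).length t ≤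
        (marginRec x l).1 := by
      rw [marginRec_fst]
      exact fun t ht => F.reachAt_le_reachRec _ _ hw' t ht
    have hle := marginRec_snd_le x l
    rw [← List.append_assoc, List.length_append (bs := [b]), List.length_singleton] at h₁ h₂ ⊢
    rw [marginRec_concat]
    have hxn : x.length ≤ (x ++ l).length := by simp
    generalize (x ++ l).length = n at *
    cases b
    · rcases Nat.lt_or_ge n (F.label t₁) with c₁ | c₁
      · have c₁ : F.label t₁ = n + 1 := by omega
        rcases Nat.lt_or_ge n (F.label t₂) with c₂ | c₂
        · have c₂ : F.label t₂ = n + 1 := by omega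
          have := (F.honest_unique (n + 1) hs).unique c₁ c₂
          subst this
          -- Both tines end at the unique vertex of this honest slot, so they share its incoming
          -- edge, whose label exceeds `x.length`.
          exact absurd ⟨t₁, (F.label_parent_lt c₁).1, F.onPath_refl _, F.onPath_refl _,
            by omega⟩ hd
        · exact F.min_reachAt_le_of_honest hs hle hR ih c₁ c₂ hd
      · rcases Nat.lt_or_ge n (F.label t₂) with c₂ | c₂
        · rw [min_comm]
          exact F.min_reachAt_le_of_honest hs hle hR ih (by omega) c₁ hd.symm
        · have := ih _ _ c₁ c₂ hd
          have := F.reachAt_succ_of_honest hs t₁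
          have := F.reachAt_succ_of_honest hs t₂
          simp only [marginStep, Bool.false_eq_true, if_false]
          split_ifs <;> omega
    -- Shortening a tine to its parent preserves disjointness, so both tines can be moved back to
    -- time `n` at a cost of one.
    · have key : ∀ t, F.label t ≤ n + 1 → ∃ t', (t' = t ∨ t' = F.parent t) ∧
          F.label t' ≤ n ∧ F.reachAt (n + 1) t ≤ F.reachAt n t' + 1 := by
        intro t ht
        rcases Nat.lt_or_ge n (F.label t) with c | c
        · have c : F.label t = n + 1 := by omega
          exact ⟨_, Or.inr rfl, (F.label_parent_lt c).2, F.reachAt_succ_le_parent hs c⟩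
        · exact ⟨t, Or.inl rfl, c, (F.reachAt_succ_of_adversarial hs c).le⟩
      obtain ⟨s₁, e₁, l₁, r₁⟩ := key t₁ h₁
      obtain ⟨s₂, e₂, l₂, r₂⟩ := key t₂ h₂
      have hd' : F.DisjointOver x s₁ s₂ := by
        have hd1 : F.DisjointOver x s₁ t₂ := by
          rcases e₁ with rfl | rfl
          exacts [hd, hd.parent_left]
        rcases e₂ with rfl | rfl
        exacts [hd1, hd1.symm.parent_left.symm]
      have := ih _ _ l₁ l₂ hd'
      simp only [marginStep, if_true]
      omega

end Fork

theorem relMargin_le_marginRec (x y : List Bool) : relMargin x y ≤ (marginRec x y).2 := by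
  obtain ⟨F, -, hF⟩ := (relMargin_isGreatest x y).1
  obtain ⟨t₁, t₂, hd, ht⟩ := (F.relMargin_isGreatest x).1
  rw [hF, ht]
  refine (min_le_min (F.reach_le_reachAt t₁) (F.reach_le_reachAt t₂)).trans ?_
  exact F.min_reachAt_le_marginRec x y [] (by simp) t₁ t₂ (F.label_le _) (F.label_le _) hd

/-! ### Expectations over random strings -/

/-- The expectation of `f` over strings of `n` independent bits, each equal to `true` with
probability `(1 - ε) / 2`. -/
noncomputable def expect (ε : ℝ) : ℕ → (List Bool → ℝ) → ℝ
  | 0, f => f []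
  | n + 1, f => (1 - ε) / 2 * expect ε n (fun l => f (true :: l)) +
      (1 + ε) / 2 * expect ε n (fun l => f (false :: l))

section Expect

variable {ε : ℝ}

theorem expect_succ (n : ℕ) (f : List Bool → ℝ) :
    expect ε (n + 1) f = (1 - ε) / 2 * expect ε n (fun l => f (true :: l)) +
      (1 + ε) / 2 * expect ε n (fun l => f (false :: l)) := rfl

theorem expect_concat (n : ℕ) (f : List Bool → ℝ) :
    expect ε (n + 1) f = (1 - ε) / 2 * expect ε n (fun l => f (l ++ [true])) +
      (1 + ε) / 2 * expect ε n (fun l => f (l ++ [false])) := by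
  induction n generalizing f with
  | zero => rfl
  | succ n ih =>
    rw [expect_succ, ih, ih, expect_succ, expect_succ]
    simp only [List.cons_append]
    ring

theorem expect_append (m k : ℕ) (f : List Bool → ℝ) :
    expect ε m (fun u => expect ε k fun v => f (u ++ v)) = expect ε (m + k) f := by
  induction m generalizing f with
  | zero => simp [expect]
  | succ m ih =>
    rw [Nat.add_right_comm, expect_succ, expect_succ, ← ih, ← ih]
    rfl

theorem expect_mono (h0 : 0 < ε) (h1 : ε < 1) {n : ℕ} {f g : List Bool → ℝ}
    (h : ∀ l, l.length = n → f l ≤ g l) : expect ε n f ≤ expect ε n g := by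
  induction n generalizing f g with
  | zero => exact h [] rfl
  | succ n ih =>
    rw [expect_succ, expect_succ]
    have ht := ih (f := fun l => f (true :: l)) (g := fun l => g (true :: l))
      fun l hl => h _ (by simp [hl])
    have hf := ih (f := fun l => f (false :: l)) (g := fun l => g (false :: l))
      fun l hl => h _ (by simp [hl])
    have hp : 0 ≤ (1 - ε) / 2 := by linarith
    have hq : 0 ≤ (1 + ε) / 2 := by linarith
    gcongr

theorem expect_const (n : ℕ) (c : ℝ) : expect ε n (fun _ => c) = c := by
  induction n with
  | zero => rfl
  | succ n ih => rw [expect_succ, ih]; ring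

theorem expect_add (n : ℕ) (f g : List Bool → ℝ) :
    expect ε n (fun l => f l + g l) = expect ε n f + expect ε n g := by
  induction n generalizing f g with
  | zero => rfl
  | succ n ih => simp only [expect_succ, ih]; ring

theorem expect_mul (n : ℕ) (c : ℝ) (f : List Bool → ℝ) :
    expect ε n (fun l => c * f l) = c * expect ε n f := by
  induction n generalizing f with
  | zero => rfl
  | succ n ih => simp only [expect_succ, ih]; ring

theorem expect_sum {ι : Type*} (s : Finset ι) (n : ℕ) (f : ι → List Bool → ℝ) :
    expect ε n (fun l => ∑ i ∈ s, f i l) = ∑ i ∈ s, expect ε n (f i) := by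
  classical
  induction s using Finset.induction_on with
  | empty => simpa using expect_const n 0
  | insert i s hi ih => simp [Finset.sum_insert hi, expect_add, ih]

end Expect

/-! ### From the measure-theoretic law to recursive expectations -/

theorem sum_bitsLaw (ε : ℝ) (hε : ε ∈ Set.Ioo (0 : ℝ) 1) (n : ℕ) (f : List Bool → ℝ) :
    ∑ u : Fin n → Bool, (bitsLaw ε hε n).real {u} * f (List.ofFn u) = expect ε n f := by
  have hb : ∀ n (u : Fin n → Bool), (bitsLaw ε hε n).real {u} =
      ∏ i, if u i then (1 - ε) / 2 else (1 + ε) / 2 := by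
    intro n u
    rw [bitsLaw, measureReal_def, Measure.pi_singleton, ENNReal.toReal_prod]
    refine Finset.prod_congr rfl fun i _ => ?_
    rw [← measureReal_def, bernoulliMeasure_real_apply _ (measurableSet_singleton _)]
    cases u i
    · simp
      ring
    · simp
  simp only [hb]
  clear hb
  induction n generalizing f with
  | zero => simp [expect]
  | succ n ih =>
    rw [← (Fin.consEquiv fun _ => Bool).sum_comp, Fintype.sum_prod_type, Fintype.sum_bool,
      expect_succ, ← ih, ← ih, Finset.mul_sum, Finset.mul_sum]
    congr 1 <;> refine Finset.sum_congr rfl fun u _ => ?_ <;>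
      simp [Fin.consEquiv, Fin.prod_univ_succ, List.ofFn_succ, mul_assoc]

theorem measureReal_pair_eq_expect (ε : ℝ) (hε : ε ∈ Set.Ioo (0 : ℝ) 1) (m k : ℕ)
    {Ω : Type*} [MeasurableSpace Ω] (P : Measure Ω) [IsProbabilityMeasure P]
    {x : Ω → Fin m → Bool} {y : Ω → Fin k → Bool}
    (hx : HasLaw x (bitsLaw ε hε m) P) (hy : HasLaw y (bitsLaw ε hε k) P) (hxy : IndepFun x y P)
    (Q : List Bool → List Bool → Prop) [∀ u v, Decidable (Q u v)] :
    P.real {ω | Q (List.ofFn (x ω)) (List.ofFn (y ω))} =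
      expect ε m fun u => expect ε k fun v => if Q u v then 1 else 0 := by
  have : ∀ n, IsProbabilityMeasure (bitsLaw ε hε n) := fun n => by
    unfold bitsLaw; infer_instance
  have hlaw : HasLaw (fun ω => (x ω, y ω)) ((bitsLaw ε hε m).prod (bitsLaw ε hε k)) P :=
    ⟨hx.aemeasurable.prodMk hy.aemeasurable, by
      rw [(indepFun_iff_map_prod_eq_prod_map_map hx.aemeasurable hy.aemeasurable).1 hxy,
        hx.map_eq, hy.map_eq]⟩
  have hS : MeasurableSet {z : (Fin m → Bool) × (Fin k → Bool) |
      Q (List.ofFn z.1) (List.ofFn z.2)} := (Set.toFinite _).measurableSet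
  have h1 := hlaw.measureReal_eq (p := fun z => Q (List.ofFn z.1) (List.ofFn z.2)) hS
  refine h1.trans ?_
  have h2 : {z : (Fin m → Bool) × (Fin k → Bool) | Q (List.ofFn z.1) (List.ofFn z.2)} =
      ((Finset.univ.filter fun z : (Fin m → Bool) × (Fin k → Bool) =>
        Q (List.ofFn z.1) (List.ofFn z.2) : Finset _) : Set _) := by
    ext; simp
  rw [h2, ← sum_measureReal_singleton, Finset.sum_filter, Fintype.sum_prod_type,
    ← sum_bitsLaw ε hε m]
  refine Finset.sum_congr rfl fun u _ => ?_
  rw [← sum_bitsLaw ε hε k, Finset.mul_sum]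
  refine Finset.sum_congr rfl fun v _ => ?_
  rw [← Set.singleton_prod_singleton, measureReal_prod_prod]
  split_ifs <;> simp

/-! ### The reach of a random string -/

/-- The reach is a walk reflected at 0 with downward drift. The geometric tail with ratio `β` is
stationary: `(1 - ε) / 2 + (1 + ε) / 2 * β ^ 2 = β`. -/
theorem expect_reachRec_tail {ε : ℝ} (h0 : 0 < ε) (h1 : ε < 1) (n j : ℕ) :
    expect ε n (fun l => if j ≤ reachRec l then 1 else 0) ≤ ((1 - ε) / (1 + ε)) ^ j := by
  have hβ : 0 ≤ (1 - ε) / (1 + ε) := div_nonneg (by linarith) (by linarith)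
  induction n generalizing j with
  | zero =>
    cases j with
    | zero => simp [expect]
    | succ j => simpa [expect, reachRec] using pow_nonneg hβ _
  | succ n ih =>
    cases j with
    | zero => simp [expect_const]
    | succ j =>
      have e1 : ∀ l, (j + 1 ≤ reachRec (l ++ [true])) = (j ≤ reachRec l) := by
        intro l; simp [reachRec_concat, reachStep]
      have e2 : ∀ l, (j + 1 ≤ reachRec (l ++ [false])) = (j + 2 ≤ reachRec l) := by
        intro l; simp only [reachRec_concat, reachStep, Bool.false_eq_true, if_false, eq_iff_iff]
        omega
      rw [expect_concat]
      simp only [e1, e2]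
      have hp : 0 ≤ (1 - ε) / 2 := by linarith
      have hq : 0 ≤ (1 + ε) / 2 := by linarith
      refine (add_le_add (mul_le_mul_of_nonneg_left (ih j) hp)
        (mul_le_mul_of_nonneg_left (ih (j + 2)) hq)).trans_eq ?_
      have hβ' : (1 + ε) * ((1 - ε) / (1 + ε)) = 1 - ε := by field_simp
      generalize (1 - ε) / (1 + ε) = β at *
      linear_combination β ^ j / 2 * (β - 1) * hβ'

theorem expect_pow_reachRec {ε : ℝ} (h0 : 0 < ε) (h1 : ε < 1) {a : ℝ} (ha : 1 ≤ a)
    (haβ : a * ((1 - ε) / (1 + ε)) < 1) (n : ℕ) :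
    expect ε n (fun l => a ^ reachRec l) ≤
      1 + (a - 1) * ((1 - ε) / (1 + ε)) / (1 - a * ((1 - ε) / (1 + ε))) := by
  have hβ : 0 ≤ (1 - ε) / (1 + ε) := div_nonneg (by linarith) (by linarith)
  have hlen : ∀ l : List Bool, reachRec l ≤ l.length := by
    intro l
    induction l using List.reverseRecOn with
    | nil => rfl
    | append_singleton l b ih =>
      rw [reachRec_concat, List.length_append, List.length_singleton, reachStep]
      split_ifs <;> omega
  -- Summation by tails: `a ^ r` is 1 plus the sum of the increments `(a - 1) * a ^ j` over `j < r`.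
  have hpow : ∀ l : List Bool, l.length = n → a ^ reachRec l ≤
      1 + ∑ j ∈ Finset.range n, (a - 1) * a ^ j * (if j + 1 ≤ reachRec l then 1 else 0) := by
    intro l hl
    have h : reachRec l ≤ n := hl ▸ hlen l
    simp only [mul_ite, mul_one, mul_zero]
    rw [← Finset.sum_filter]
    have : (Finset.range n).filter (fun j => j + 1 ≤ reachRec l) = Finset.range (reachRec l) := by
      ext j; simp only [Finset.mem_filter, Finset.mem_range]; omega
    rw [this, ← Finset.mul_sum, mul_geom_sum]
    linarith
  refine (expect_mono h0 h1 hpow).trans ?_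
  rw [expect_add, expect_const, expect_sum]
  simp only [expect_mul]
  gcongr
  have hb := fun j => expect_reachRec_tail h0 h1 n (j + 1)
  generalize (1 - ε) / (1 + ε) = β at *
  calc _ ≤ ∑ j ∈ Finset.range n, (a - 1) * a ^ j * β ^ (j + 1) := by
        refine Finset.sum_le_sum fun j _ => mul_le_mul_of_nonneg_left (hb j) ?_
        exact mul_nonneg (by linarith) (by positivity)
    _ = (a - 1) * β * ∑ j ∈ Finset.range n, (a * β) ^ j := by
        rw [Finset.mul_sum]
        refine Finset.sum_congr rfl fun j _ => ?_
        rw [mul_pow]; ring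
    _ ≤ (a - 1) * β * (1 - a * β)⁻¹ := by
        refine mul_le_mul_of_nonneg_left ?_ (mul_nonneg (by linarith) hβ)
        rw [← tsum_geometric_of_lt_one (mul_nonneg (by linarith) hβ) haβ]
        exact (summable_geometric_of_lt_one (mul_nonneg (by linarith) hβ) haβ).sum_le_tsum _
          fun j _ => pow_nonneg (mul_nonneg (by linarith) hβ) j
    _ = _ := by rw [div_eq_mul_inv]

/-! ### A supermartingale for the margin -/

/-- The potential of a pair (maximal reach, relative margin). -/
noncomputable def potential (a b : ℝ) (s : ℕ × ℤ) : ℝ := a ^ s.1 * b ^ (-s.2).toNat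

/-- While the margin is nonnegative and the reach positive, the margin cannot turn negative and the
decay comes from the reach (`hpos`). At negative margin, the factor `1 - ε` supplies the decay
(`hneg`); `hneg` also covers the state where both are 0. -/
theorem potential_step {ε a c : ℝ} (h0 : 0 < ε) (h1 : ε < 1) (ha : 1 ≤ a)
    (hpos : (1 - ε) / 2 * a ^ 2 + (1 + ε) / 2 ≤ c * a)
    (hneg : a / 2 + (1 + ε) * (1 - ε) / 2 ≤ c) {s : ℕ × ℤ} (hs : s.2 ≤ s.1) :
    (1 - ε) / 2 * potential a (1 - ε) (marginStep s true) +
      (1 + ε) / 2 * potential a (1 - ε) (marginStep s false) ≤ c * potential a (1 - ε) s := by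
  obtain ⟨r, m⟩ := s
  simp only [potential, marginStep, reachStep, if_true, Bool.false_eq_true, if_false] at hs ⊢
  have hb : 0 < 1 - ε := by linarith
  rcases lt_or_ge m 0 with hm | hm
  · rw [if_neg (by omega)]
    obtain ⟨n, rfl⟩ : ∃ n : ℕ, m = -(n + 1 : ℤ) := ⟨(-m - 1).toNat, by omega⟩
    have e1 : (-(-(n + 1 : ℤ) + 1)).toNat = n := by omega
    have e2 : (-(-(n + 1 : ℤ) - 1)).toNat = n + 2 := by omega
    have e3 : (-(-(n + 1 : ℤ))).toNat = n + 1 := by omega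
    rw [e1, e2, e3]
    -- The gain from a falling reach is discarded, which also covers `r = 0`, where the reach does
    -- not fall.
    have har : a ^ (r - 1) ≤ a ^ r := pow_le_pow_right₀ ha (by omega)
    calc _ ≤ (1 - ε) / 2 * (a ^ (r + 1) * (1 - ε) ^ n) +
          (1 + ε) / 2 * (a ^ r * (1 - ε) ^ (n + 2)) := by gcongr
      _ = (a / 2 + (1 + ε) * (1 - ε) / 2) * (a ^ r * (1 - ε) ^ (n + 1)) := by ring
      _ ≤ _ := by gcongr
  · have e1 : (-(m + 1)).toNat = 0 := by omega
    have e3 : (-m).toNat = 0 := by omega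
    cases r with
    | zero =>
      have hm0 : m = 0 := by push_cast at hs; omega
      subst hm0
      have e4 : (-((0 : ℤ) - 1)).toNat = 1 := rfl
      rw [if_neg (by omega), e1, e3, e4, Nat.zero_sub, Nat.zero_add, pow_zero, pow_zero, pow_one,
        pow_one]
      have : 0 < ε * a := mul_pos h0 (by linarith)
      linarith
    | succ r =>
      have e2 : (-(if m = 0 ∧ 0 < r + 1 then 0 else m - 1)).toNat = 0 := by
        split_ifs <;> omega
      rw [e1, e2, e3]
      simp only [pow_zero, mul_one, Nat.add_sub_cancel]
      calc _ = ((1 - ε) / 2 * a ^ 2 + (1 + ε) / 2) * a ^ r := by ring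
        _ ≤ c * a * a ^ r := by gcongr
        _ = _ := by ring

theorem expect_margin_nonneg_le {ε a c : ℝ} (h0 : 0 < ε) (h1 : ε < 1) (ha : 1 ≤ a) (hc : 0 ≤ c)
    (hpos : (1 - ε) / 2 * a ^ 2 + (1 + ε) / 2 ≤ c * a)
    (hneg : a / 2 + (1 + ε) * (1 - ε) / 2 ≤ c) (k : ℕ) {s : ℕ × ℤ} (hs : s.2 ≤ s.1) :
    expect ε k (fun v => if 0 ≤ (v.foldl marginStep s).2 then 1 else 0) ≤
      c ^ k * potential a (1 - ε) s := by
  induction k generalizing s with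
  | zero =>
    have hb : 0 < 1 - ε := by linarith
    rw [pow_zero, one_mul, potential]
    change (if 0 ≤ s.2 then (1 : ℝ) else 0) ≤ _
    by_cases h : 0 ≤ s.2
    · rw [if_pos h]
      rw [show (-s.2).toNat = 0 by omega, pow_zero, mul_one]
      exact one_le_pow₀ ha
    · rw [if_neg h]
      positivity
  | succ k ih =>
    have hp : 0 ≤ (1 - ε) / 2 := by linarith
    have hq : 0 ≤ (1 + ε) / 2 := by linarith
    have it := ih (marginStep_snd_le hs true)
    have hf := ih (marginStep_snd_le hs false)
    rw [expect_succ]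
    calc _ ≤ (1 - ε) / 2 * (c ^ k * potential a (1 - ε) (marginStep s true)) +
          (1 + ε) / 2 * (c ^ k * potential a (1 - ε) (marginStep s false)) :=
          add_le_add (mul_le_mul_of_nonneg_left it hp) (mul_le_mul_of_nonneg_left hf hq)
      _ = c ^ k * ((1 - ε) / 2 * potential a (1 - ε) (marginStep s true) +
          (1 + ε) / 2 * potential a (1 - ε) (marginStep s false)) := by ring
      _ ≤ c ^ k * (c * potential a (1 - ε) s) := by
          gcongr
          exact potential_step h0 h1 ha hpos hneg hs
      _ = _ := by ring

/-! ### Bounds on the probability of a nonnegative margin -/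

/-- The probability that the margin is nonnegative, for the recursion. -/
noncomputable def marginProb (ε : ℝ) (m k : ℕ) : ℝ :=
  expect ε m fun u => expect ε k fun v => if 0 ≤ (marginRec u v).2 then 1 else 0

theorem marginProb_le_one {ε : ℝ} (h0 : 0 < ε) (h1 : ε < 1) (m k : ℕ) :
    marginProb ε m k ≤ 1 := by
  have h : ∀ u, expect ε k (fun v => if 0 ≤ (marginRec u v).2 then (1 : ℝ) else 0) ≤ 1 :=
    fun u => (expect_mono h0 h1 (g := fun _ => 1) fun v _ => by split_ifs <;> simp).trans_eq
      (expect_const k 1)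
  exact (expect_mono h0 h1 (g := fun _ => 1) fun u _ => h u).trans_eq (expect_const m 1)

/-- After a final honest symbol the margin is nonnegative only if the reach before it was positive,
which the tail bound for `m + k` symbols controls. -/
theorem marginProb_succ_le {ε : ℝ} (h0 : 0 < ε) (h1 : ε < 1) (m k : ℕ) :
    marginProb ε m (k + 1) ≤ 1 - ε := by
  have hp : 0 ≤ (1 - ε) / 2 := by linarith
  have hq : 0 ≤ (1 + ε) / 2 := by linarith
  have hk : ∀ u, expect ε (k + 1) (fun v => if 0 ≤ (marginRec u v).2 then (1 : ℝ) else 0) ≤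
      (1 - ε) / 2 + (1 + ε) / 2 *
        expect ε k (fun v => if 1 ≤ reachRec (u ++ v) then (1 : ℝ) else 0) := by
    intro u
    rw [expect_concat]
    gcongr
    · refine mul_le_of_le_one_right hp ?_
      exact (expect_mono h0 h1 (g := fun _ => 1) fun v _ => by split_ifs <;> simp).trans_eq
        (expect_const k 1)
    · refine expect_mono h0 h1 fun v _ => ?_
      have h2 := marginRec_snd_le u v
      rw [marginRec_concat, ← marginRec_fst]
      by_cases h3 : 1 ≤ (marginRec u v).1
      · rw [if_pos h3]
        split_ifs <;> simp
      · rw [if_neg h3, if_neg]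
        simp only [marginStep, Bool.false_eq_true, if_false]
        rw [if_neg (by omega)]
        omega
  refine (expect_mono h0 h1 fun u _ => hk u).trans ?_
  rw [expect_add, expect_const, expect_mul,
    expect_append m k (fun l => if 1 ≤ reachRec l then (1 : ℝ) else 0)]
  have h3 := mul_le_mul_of_nonneg_left (expect_reachRec_tail h0 h1 (m + k) 1) hq
  have h4 : (1 + ε) / 2 * ((1 - ε) / (1 + ε)) ^ 1 = (1 - ε) / 2 := by field_simp
  linarith

theorem marginProb_le_mul_pow {ε : ℝ} (h0 : 0 < ε) (h1 : ε ≤ 1 / 100) (m k : ℕ) :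
    marginProb ε m k ≤ (1 + ε / 2) * (1 - 3 / 4 * ε ^ 3) ^ k := by
  have h1' : ε < 1 := by linarith
  -- For `a = 1 + α * ε ^ 2`, to leading order `hneg` requires `α < 1` and `hpos` gives decay `α * ε
  -- ^ 3`; `4 / 5` lies between the target `3 / 4` and 1.
  set a : ℝ := 1 + 4 / 5 * ε ^ 2 with ha_def
  set c : ℝ := 1 - 3 / 4 * ε ^ 3 with hc_def
  have hε2 : 0 < ε ^ 2 := by positivity
  have hε3 : ε ^ 3 ≤ ε ^ 2 / 100 := by nlinarith
  have hε4 : ε ^ 4 ≤ ε ^ 3 / 100 := by nlinarith [pow_pos h0 3]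
  have hε5 : ε ^ 5 ≤ ε ^ 3 / 100 := by nlinarith [pow_pos h0 3, pow_pos h0 4]
  have hε2' : ε ^ 2 ≤ ε / 100 := by nlinarith
  have ha : 1 ≤ a := by linarith
  have hc : 0 ≤ c := by nlinarith
  have hpos : (1 - ε) / 2 * a ^ 2 + (1 + ε) / 2 ≤ c * a := by
    have : c * a - ((1 - ε) / 2 * a ^ 2 + (1 + ε) / 2) =
      ε ^ 3 / 20 - 8 / 25 * ε ^ 4 - 7 / 25 * ε ^ 5 := by rw [ha_def, hc_def]; ring
    have := pow_pos h0 3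
    linarith
  have hneg : a / 2 + (1 + ε) * (1 - ε) / 2 ≤ c := by
    rw [ha_def, hc_def]
    nlinarith
  have haβ : a * ((1 - ε) / (1 + ε)) < 1 := by
    rw [mul_div_assoc', div_lt_one (by linarith), ha_def]
    nlinarith
  have hE := expect_pow_reachRec h0 h1' ha haβ m
  have hA : 1 + (a - 1) * ((1 - ε) / (1 + ε)) / (1 - a * ((1 - ε) / (1 + ε))) ≤ 1 + ε / 2 := by
    refine add_le_add_right ?_ 1
    rw [div_le_iff₀ (by linarith)]
    have : (1 + ε) * ((1 - ε) / (1 + ε)) = 1 - ε := by field_simp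
    rw [← mul_le_mul_iff_right₀ (by linarith : 0 < 1 + ε)]
    generalize (1 - ε) / (1 + ε) = β at *
    have e1 : (1 + ε) * ((a - 1) * β) = (a - 1) * (1 - ε) := by linear_combination (a - 1) * this
    have e2 : (1 + ε) * (ε / 2 * (1 - a * β)) = ε / 2 * (1 + ε - a * (1 - ε)) := by
      linear_combination - ε / 2 * a * this
    rw [e1, e2, ha_def]
    nlinarith
  have hstep : marginProb ε m k ≤ expect ε m (fun u => c ^ k * a ^ reachRec u) := by
    refine expect_mono h0 h1' fun u _ => ?_
    have := expect_margin_nonneg_le h0 h1' ha hc hpos hneg k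
      (s := (reachRec u, (reachRec u : ℤ))) le_rfl
    refine this.trans_eq ?_
    simp [potential]
  refine hstep.trans ?_
  rw [expect_mul, mul_comm]
  exact mul_le_mul_of_nonneg_right (hE.trans hA) (by positivity)

theorem marginProb_le_exp {ε : ℝ} (h0 : 0 < ε) (h1 : ε ≤ 1 / 100) (m k : ℕ) :
    marginProb ε m k ≤ Real.exp (-(ε ^ 3 * k / 2)) := by
  have h1' : ε < 1 := by linarith
  -- Beyond this threshold the spare decay `ε ^ 3 * k / 4` exceeds the `ε / 2` from the prefactor;
  -- below it, `ε ^ 3 * k / 2 ≤ ε`.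
  rcases le_or_gt (ε ^ 2 * k) 2 with hk | hk
  · cases k with
    | zero => simpa using marginProb_le_one h0 h1' m 0
    | succ k =>
      refine (marginProb_succ_le h0 h1' m k).trans ?_
      refine (Real.one_sub_le_exp_neg ε).trans (Real.exp_le_exp.2 ?_)
      nlinarith
  · refine (marginProb_le_mul_pow h0 h1 m k).trans ?_
    have hc : 0 ≤ 1 - 3 / 4 * ε ^ 3 := by
      have : ε ^ 3 ≤ 1 := pow_le_one₀ h0.le h1'.le
      linarith
    have e1 : 1 + ε / 2 ≤ Real.exp (ε / 2) := by
      linarith [Real.add_one_le_exp (ε / 2)]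
    have e2 : (1 - 3 / 4 * ε ^ 3) ^ k ≤ Real.exp (-(3 / 4 * ε ^ 3) * k) := by
      rw [mul_comm _ (k : ℝ), Real.exp_nat_mul]
      exact pow_le_pow_left₀ hc (Real.one_sub_le_exp_neg _) k
    refine (mul_le_mul e1 e2 (by positivity) (by positivity)).trans ?_
    rw [← Real.exp_add]
    refine Real.exp_le_exp.2 ?_
    nlinarith

end ForkMargin

theorem mainTheorem4 :
    ∃ C : ℝ, ∀ (ε : ℝ) (hε : ε ∈ Set.Ioo (0 : ℝ) 1) (m k : ℕ)
      {Ω : Type*} [MeasurableSpace Ω] (P : Measure Ω) [IsProbabilityMeasure P]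
      (x : Ω → Fin m → Bool) (y : Ω → Fin k → Bool),
      HasLaw x (ForkMargin.bitsLaw ε hε m) P →
      HasLaw y (ForkMargin.bitsLaw ε hε k) P →
      IndepFun x y P →
      P.real {ω | 0 ≤ ForkMargin.relMargin (List.ofFn (x ω)) (List.ofFn (y ω))}
        ≤ Real.exp (-(ε ^ 3 * (1 - C * ε) * k / 2)) := by
  -- With this constant the bound is trivial for `ε > 1 / 100`; for smaller `ε` the estimate holds
  -- even without the correction term.
  refine ⟨100, fun ε hε m k Ω _ P _ x y hx hy hxy => ?_⟩
  obtain ⟨h0, h1⟩ := hε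
  have hk : (0 : ℝ) ≤ k := k.cast_nonneg
  have h3 : 0 < ε ^ 3 := by positivity
  rcases le_or_gt ε (1 / 100) with h | h
  · have hmono : P.real {ω | 0 ≤ ForkMargin.relMargin (List.ofFn (x ω)) (List.ofFn (y ω))} ≤
        P.real {ω | 0 ≤ (ForkMargin.marginRec (List.ofFn (x ω)) (List.ofFn (y ω))).2} :=
      measureReal_mono fun ω hω => le_trans hω (ForkMargin.relMargin_le_marginRec _ _)
    have heq := ForkMargin.measureReal_pair_eq_expect ε ⟨h0, h1⟩ m k P hx hy hxy
      fun u v => 0 ≤ (ForkMargin.marginRec u v).2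
    have hle := ForkMargin.marginProb_le_exp h0 h m k
    rw [ForkMargin.marginProb] at hle
    refine hmono.trans (heq.trans_le (hle.trans (Real.exp_le_exp.2 ?_)))
    have : 0 ≤ ε ^ 3 * (100 * ε) * k := by positivity
    linarith
  · refine measureReal_le_one.trans (Real.one_le_exp ?_)
    have : 0 ≤ ε ^ 3 * k * (100 * ε - 1) := mul_nonneg (by positivity) (by linarith)
    linarith
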